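/- Let $n$ be a natural number and let $|||\cdot|||$ be a norm on the complex vector space $M_n(\mathbb{C})$ of complex $n\times n$ matrices that is unitarily invariant, that is, $|||uav||| = |||a|||$ for all $a \in M_n(\mathbb{C})$ and all unitary matrices $u, v \in M_n(\mathbb{C})$. Then $|||\cdot|||$ is 2-positive: for all $a, b, c \in M_n(\mathbb{C})$ such that the block matrix $$\begin{pmatrix} a & c \\ c^* & b \end{pmatrix} \in M_2(M_n(\mathbb{C})) = M_{2n}(\mathbb{C})$$ is positive semidefinite, the $2\times 2$ matrix $$\begin{pmatrix} |||a||| & |||c||| \\ |||c^*||| & |||b||| \end{pmatrix} \in M_2(\mathbb{C})$$ is positive semidefinite. -/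

import Mathlib

open scoped ComplexOrder

/-- A norm on the complex vector space `M_n(ℂ)` with `|||u a v||| = |||a|||` for all unitaries
`u`, `v`. The seminorm axioms come from `Seminorm ℂ`; definiteness makes it a norm. -/
structure IsUnitarilyInvariantNorm {n : ℕ} (N : Seminorm ℂ (Matrix (Fin n) (Fin n) ℂ)) : Prop where
  eq_zero_of_map_eq_zero : ∀ a : Matrix (Fin n) (Fin n) ℂ, N a = 0 → a = 0
  map_unitary_mul_mul : ∀ u ∈ Matrix.unitaryGroup (Fin n) ℂ, ∀ v ∈ Matrix.unitaryGroup (Fin n) ℂ,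
    ∀ a : Matrix (Fin n) (Fin n) ℂ, N (u * a * v) = N a

/-- A (not necessarily linear) functional `φ` on `M_n(ℂ)` is 2-positive if the scalar matrix
`(φ(a), φ(c); φ(c*), φ(b))` is positive semidefinite whenever the block matrix `(a, c; c*, b)` is. -/
def IsTwoPositive {n : ℕ} (φ : Matrix (Fin n) (Fin n) ℂ → ℂ) : Prop :=
  ∀ a b c : Matrix (Fin n) (Fin n) ℂ,
    (Matrix.fromBlocks a c c.conjTranspose b).PosSemidef →
      (!![φ a, φ c; φ c.conjTranspose, φ b] : Matrix (Fin 2) (Fin 2) ℂ).PosSemidef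

open Matrix

section UnitarilyInvariant

variable {n : ℕ} {N : Seminorm ℂ (Matrix (Fin n) (Fin n) ℂ)}

/-! For invertible `c`, write `c = w * p` with `w` unitary and `p ≥ 0`. Compressing the block matrix
by the column `(w, -1)` gives `2p ≤ wᴴ a w + b`; monotonicity of `N` on positive matrices
(`map_le_of_posSemidef`) turns this into `2 N c ≤ N a + N b`. A small shift of `c` removes
invertibility, and rescaling the blocks upgrades the bound to `N c ^ 2 ≤ N a * N b`. As `N cᴴ = N
c`, this is the determinant condition for the 2×2 matrix. -/

theorem IsUnitarilyInvariantNorm.map_unitary_mul (hN : IsUnitarilyInvariantNorm N)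
    {u : Matrix (Fin n) (Fin n) ℂ} (hu : u ∈ unitaryGroup (Fin n) ℂ)
    (a : Matrix (Fin n) (Fin n) ℂ) : N (u * a) = N a := by
  simpa using hN.map_unitary_mul_mul u hu 1 (one_mem _) a

theorem IsUnitarilyInvariantNorm.map_mul_unitary (hN : IsUnitarilyInvariantNorm N)
    {v : Matrix (Fin n) (Fin n) ℂ} (hv : v ∈ unitaryGroup (Fin n) ℂ)
    (a : Matrix (Fin n) (Fin n) ℂ) : N (a * v) = N a := by
  simpa using hN.map_unitary_mul_mul 1 (one_mem _) v hv a

/-! ### Pinching and monotonicity -/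

theorem diagonal_mem_unitaryGroup {d : Fin n → ℂ} (hd : ∀ i, d i * star (d i) = 1) :
    diagonal d ∈ unitaryGroup (Fin n) ℂ := by
  rw [mem_unitaryGroup_iff, star_eq_conjTranspose, diagonal_conjTranspose, diagonal_mul_diagonal,
    ← diagonal_one]
  congr 1
  funext i
  exact hd i

/-- Averaging the conjugates of `a` by the powers of `diagonal (ζ ^ i)` kills the off-diagonal. -/
theorem sum_conj_diagonal_pow_eq (hn : n ≠ 0) {ζ : ℂ} (hζ : IsPrimitiveRoot ζ n)
    (a : Matrix (Fin n) (Fin n) ℂ) :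
    ∑ k ∈ Finset.range n, diagonal (fun i : Fin n => ζ ^ (k * (i : ℕ))) * a *
      diagonal (fun i : Fin n => (ζ⁻¹) ^ (k * (i : ℕ))) = (n : ℂ) • diagonal a.diag := by
  have h0 : ζ ≠ 0 := hζ.ne_zero hn
  ext i j
  rw [Matrix.sum_apply]
  simp only [mul_diagonal, diagonal_mul, Matrix.smul_apply, smul_eq_mul]
  have key : ∀ k : ℕ, ζ ^ (k * (i : ℕ)) * a i j * ζ⁻¹ ^ (k * (j : ℕ)) =
      (ζ ^ (i : ℕ) * ζ⁻¹ ^ (j : ℕ)) ^ k * a i j := by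
    intro k
    rw [mul_pow, ← pow_mul, ← pow_mul, mul_comm k, mul_comm k]
    ring
  simp only [key, ← Finset.sum_mul]
  by_cases hij : i = j
  · subst hij
    have : ζ ^ (i : ℕ) * ζ⁻¹ ^ (i : ℕ) = 1 := by rw [← mul_pow, mul_inv_cancel₀ h0, one_pow]
    simp only [this, one_pow]
    simp
  · set z := ζ ^ (i : ℕ) * ζ⁻¹ ^ (j : ℕ) with hz
    have hz1 : z ≠ 1 := by
      intro h
      have : ζ ^ (i : ℕ) = ζ ^ (j : ℕ) := by
        rw [hz, inv_pow, ← div_eq_mul_inv, div_eq_one_iff_eq (pow_ne_zero _ h0)] at h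
        exact h
      exact hij (Fin.ext (hζ.pow_inj i.2 j.2 this))
    have hzn : z ^ n = 1 := by
      rw [hz, mul_pow, ← pow_mul, ← pow_mul, mul_comm, mul_comm (j : ℕ), mul_comm (i : ℕ),
        pow_mul, pow_mul, inv_pow, hζ.pow_eq_one]
      simp
    have : ∑ k ∈ Finset.range n, z ^ k = 0 := by
      rw [geom_sum_eq hz1, hzn]; simp
    simp [this, hij]

theorem IsUnitarilyInvariantNorm.map_diagonal_diag_le (hN : IsUnitarilyInvariantNorm N)
    (a : Matrix (Fin n) (Fin n) ℂ) : N (diagonal a.diag) ≤ N a := by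
  rcases eq_or_ne n 0 with rfl | hn
  · exact (congrArg N (Subsingleton.elim _ _)).le
  set ζ : ℂ := Complex.exp (2 * Real.pi * Complex.I / n)
  have hζ : IsPrimitiveRoot ζ n := Complex.isPrimitiveRoot_exp n hn
  have hnorm : ‖ζ‖ = 1 := hζ.norm'_eq_one hn
  have hn' : (0 : ℝ) < n := by positivity
  have h1 : N ((n : ℂ) • diagonal a.diag) ≤ n * N a := by
    rw [← sum_conj_diagonal_pow_eq hn hζ a]
    refine (Finset.le_sum_of_subadditive N (map_zero N).le (map_add_le_add N) _ _).trans ?_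
    rw [Finset.sum_congr rfl (g := fun _ => N a)]
    · simp
    · intro k _
      apply hN.map_unitary_mul_mul <;>
      · refine diagonal_mem_unitaryGroup fun i => ?_
        rw [← starRingEnd_apply, Complex.mul_conj']
        simp [hnorm]
  rw [map_smul_eq_mul] at h1
  simp only [RCLike.norm_natCast] at h1
  exact le_of_mul_le_mul_left h1 hn'

/-- Since `d i = Re (u i) * e i` with `u i` unimodular, the smaller diagonal is the midpoint of two
unitary multiples of the larger. -/
theorem IsUnitarilyInvariantNorm.map_diagonal_ofReal_le (hN : IsUnitarilyInvariantNorm N)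
    {d e : Fin n → ℝ} (hd : ∀ i, 0 ≤ d i) (hde : ∀ i, d i ≤ e i) :
    N (diagonal fun i => (d i : ℂ)) ≤ N (diagonal fun i => (e i : ℂ)) := by
  set t : Fin n → ℝ := fun i => d i / e i
  have ht0 : ∀ i, 0 ≤ t i := fun i => div_nonneg (hd i) ((hd i).trans (hde i))
  have ht1 : ∀ i, t i ≤ 1 := fun i => div_le_one_of_le₀ (hde i) ((hd i).trans (hde i))
  have hte : ∀ i, d i = t i * e i := by
    intro i
    rcases eq_or_ne (e i) 0 with h | h
    · rw [h, mul_zero]; exact le_antisymm (h ▸ hde i) (hd i)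
    · exact (div_mul_cancel₀ _ h).symm
  set s : Fin n → ℝ := fun i => Real.sqrt (1 - t i ^ 2)
  have hs : ∀ i, s i ^ 2 = 1 - t i ^ 2 := fun i =>
    Real.sq_sqrt (by nlinarith [ht0 i, ht1 i])
  set u : Fin n → ℂ := fun i => ⟨t i, s i⟩
  have hu : ∀ i, u i * star (u i) = 1 := by
    intro i
    have := hs i
    apply Complex.ext <;> simp [u]
    · nlinarith
    · ring
  have hu' : ∀ i, star (u i) * star (star (u i)) = 1 := by
    intro i; rw [star_star, mul_comm]; exact hu i
  have key : (diagonal fun i => (d i : ℂ)) = (1 / 2 : ℂ) •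
      (diagonal u * (diagonal fun i => (e i : ℂ)) +
        diagonal (fun i => star (u i)) * (diagonal fun i => (e i : ℂ))) := by
    rw [diagonal_mul_diagonal, diagonal_mul_diagonal, diagonal_add, ← diagonal_smul]
    congr 1
    funext i
    apply Complex.ext <;> simp [u, hte i]
    ring
  rw [key, map_smul_eq_mul, show ‖(1 / 2 : ℂ)‖ = 1 / 2 by norm_num]
  have h := map_add_le_add N (diagonal u * (diagonal fun i => (e i : ℂ)))
    (diagonal (fun i => star (u i)) * (diagonal fun i => (e i : ℂ)))
  rw [hN.map_unitary_mul (diagonal_mem_unitaryGroup hu),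
    hN.map_unitary_mul (diagonal_mem_unitaryGroup hu')] at h
  linarith

/-- A unitarily invariant norm is monotone on positive semidefinite matrices. -/
theorem IsUnitarilyInvariantNorm.map_le_of_posSemidef (hN : IsUnitarilyInvariantNorm N)
    {h g : Matrix (Fin n) (Fin n) ℂ} (hh : h.PosSemidef) (hg : (g - h).PosSemidef) :
    N h ≤ N g := by
  set U := hh.1.eigenvectorUnitary
  have hU : (U : Matrix (Fin n) (Fin n) ℂ) ∈ unitaryGroup (Fin n) ℂ := U.2
  have hU' : (star U : Matrix (Fin n) (Fin n) ℂ) ∈ unitaryGroup (Fin n) ℂ := (star U).2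
  set d := hh.1.eigenvalues
  have hUU : (star U : Matrix (Fin n) (Fin n) ℂ) * U = 1 := mem_unitaryGroup_iff'.1 hU
  have hspec : (star U : Matrix (Fin n) (Fin n) ℂ) * h * U = diagonal fun i => (d i : ℂ) := by
    have := hh.1.spectral_theorem
    rw [Unitary.conjStarAlgAut_apply] at this
    conv_lhs => rw [this]
    change _ * (_ * diagonal (fun i => (d i : ℂ)) * _) * _ = _
    calc (star U : Matrix (Fin n) (Fin n) ℂ) * (U * diagonal (fun i => (d i : ℂ)) *
          (star U : Matrix (Fin n) (Fin n) ℂ)) * U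
        = ((star U : Matrix (Fin n) (Fin n) ℂ) * U) * diagonal (fun i => (d i : ℂ)) *
          ((star U : Matrix (Fin n) (Fin n) ℂ) * U) := by simp only [Matrix.mul_assoc]
      _ = _ := by rw [hUU, Matrix.one_mul, Matrix.mul_one]
  set g' := (star U : Matrix (Fin n) (Fin n) ℂ) * g * U
  have hgh : (g' - diagonal fun i => (d i : ℂ)).PosSemidef := by
    rw [← hspec, ← Matrix.sub_mul, ← Matrix.mul_sub]
    exact hg.conjTranspose_mul_mul_same _
  -- In an eigenbasis of `h`, only the diagonal of `g` matters: it dominates the eigenvalues of `h`,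
  -- and pinching bounds its norm by `N g`.
  have hd : ∀ i, 0 ≤ d i := hh.eigenvalues_nonneg
  have hdiag : ∀ i, (d i : ℂ) ≤ g' i i := by
    intro i
    have := hgh.diag_nonneg (i := i)
    rw [Matrix.sub_apply, diagonal_apply_eq] at this
    exact sub_nonneg.1 this
  have hre : ∀ i, ((g' i i).re : ℂ) = g' i i := by
    intro i
    have := (Complex.le_def.1 (hdiag i)).2
    apply Complex.ext
    · simp
    · simpa using this
  calc N h = N ((star U : Matrix (Fin n) (Fin n) ℂ) * h * U) :=
        (hN.map_unitary_mul_mul _ hU' _ hU h).symm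
    _ = N (diagonal fun i => (d i : ℂ)) := by rw [hspec]
    _ ≤ N (diagonal fun i => ((g' i i).re : ℂ)) :=
        hN.map_diagonal_ofReal_le hd fun i => by simpa using (Complex.le_def.1 (hdiag i)).1
    _ = N (diagonal g'.diag) := by simp only [hre]; rfl
    _ ≤ N g' := hN.map_diagonal_diag_le g'
    _ = N g := hN.map_unitary_mul_mul _ hU' _ hU g

/-! ### Polar decomposition and the invertible case -/

open scoped MatrixOrder in
theorem exists_polar_of_isUnit {c : Matrix (Fin n) (Fin n) ℂ} (hc : IsUnit c) :
    ∃ w h : Matrix (Fin n) (Fin n) ℂ,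
      w ∈ unitaryGroup (Fin n) ℂ ∧ h.PosSemidef ∧ c = w * h := by
  have hP : (cᴴ * c).PosSemidef := posSemidef_conjTranspose_mul_self c
  set h := CFC.sqrt (cᴴ * c)
  have hpos : h.PosSemidef := nonneg_iff_posSemidef.1 (CFC.sqrt_nonneg _)
  have hsq : h * h = cᴴ * c := CFC.sqrt_mul_sqrt_self _ (nonneg_iff_posSemidef.2 hP)
  have hu : IsUnit h := by
    have : IsUnit (h * h) := by rw [hsq]; exact hc.star.mul hc
    exact ((Commute.refl h).isUnit_mul_iff.1 this).1
  have hdet : IsUnit h.det := (isUnit_iff_isUnit_det h).1 hu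
  refine ⟨c * h⁻¹, h, ?_, hpos, ?_⟩
  · rw [mem_unitaryGroup_iff', star_eq_conjTranspose, conjTranspose_mul,
      conjTranspose_nonsing_inv, hpos.1.eq]
    calc h⁻¹ * cᴴ * (c * h⁻¹) = h⁻¹ * (cᴴ * c) * h⁻¹ := by simp only [Matrix.mul_assoc]
      _ = (h⁻¹ * h) * (h * h⁻¹) := by rw [← hsq]; simp only [Matrix.mul_assoc]
      _ = 1 := by rw [nonsing_inv_mul _ hdet, mul_nonsing_inv _ hdet, Matrix.one_mul]
  · rw [Matrix.mul_assoc, nonsing_inv_mul _ hdet, Matrix.mul_one]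

/-- Singular shifts lie in the finite spectrum of `-c`. -/
theorem exists_isUnit_add_smul_one (c : Matrix (Fin n) (Fin n) ℂ) {δ : ℝ} (hδ : 0 < δ) :
    ∃ ε : ℝ, 0 < ε ∧ ε < δ ∧ IsUnit (c + (ε : ℂ) • (1 : Matrix (Fin n) (Fin n) ℂ)) := by
  have hfin : (spectrum ℂ (-c)).Finite := Matrix.finite_spectrum _
  have hfin' : ((fun x : ℝ => (x : ℂ)) ⁻¹' spectrum ℂ (-c)).Finite :=
    hfin.preimage Complex.ofReal_injective.injOn
  obtain ⟨ε, hε, hε'⟩ := (Set.Ioo_infinite hδ).exists_notMem_finite hfin'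
  refine ⟨ε, hε.1, hε.2, ?_⟩
  have := spectrum.notMem_iff.1 hε'
  rwa [sub_neg_eq_add, Algebra.algebraMap_eq_smul_one, add_comm] at this

theorem IsUnitarilyInvariantNorm.map_conjTranspose_of_isUnit (hN : IsUnitarilyInvariantNorm N)
    {c : Matrix (Fin n) (Fin n) ℂ} (hc : IsUnit c) : N cᴴ = N c := by
  obtain ⟨w, h, hw, hh, rfl⟩ := exists_polar_of_isUnit hc
  rw [conjTranspose_mul, hh.1.eq, hN.map_unitary_mul hw]
  exact hN.map_mul_unitary (Unitary.star_mem hw) h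

theorem IsUnitarilyInvariantNorm.two_mul_map_le_of_isUnit (hN : IsUnitarilyInvariantNorm N)
    {a b c : Matrix (Fin n) (Fin n) ℂ} (hc : IsUnit c)
    (h : (fromBlocks a c cᴴ b).PosSemidef) : 2 * N c ≤ N a + N b := by
  obtain ⟨w, p, hw, hp, rfl⟩ := exists_polar_of_isUnit hc
  have hww : wᴴ * w = 1 := mem_unitaryGroup_iff'.1 hw
  have hpos := h.conjTranspose_mul_mul_same (fromRows w (-1 : Matrix (Fin n) (Fin n) ℂ))
  have heq : (fromRows w (-1 : Matrix (Fin n) (Fin n) ℂ))ᴴ *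
      fromBlocks a (w * p) (w * p)ᴴ b * fromRows w (-1 : Matrix (Fin n) (Fin n) ℂ) =
      (wᴴ * a * w + b) - (2 : ℂ) • p := by
    rw [Matrix.mul_assoc, fromBlocks_mul_fromRows, conjTranspose_fromRows_eq_fromCols_conjTranspose,
      fromCols_mul_fromRows, conjTranspose_mul, hp.1.eq, two_smul]
    simp only [Matrix.mul_add, Matrix.mul_assoc, hww, Matrix.mul_neg, Matrix.mul_one,
      conjTranspose_neg, conjTranspose_one, Matrix.neg_mul, Matrix.one_mul]
    rw [← Matrix.mul_assoc wᴴ w, hww, Matrix.one_mul]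
    abel
  rw [heq] at hpos
  have hp2 : ((2 : ℂ) • p).PosSemidef := hp.smul (by norm_num)
  have := hN.map_le_of_posSemidef hp2 hpos
  rw [map_smul_eq_mul] at this
  have h2 := map_add_le_add N (wᴴ * a * w) b
  rw [← star_eq_conjTranspose, hN.map_unitary_mul_mul _ (Unitary.star_mem hw) _ hw,
    star_eq_conjTranspose] at h2
  rw [hN.map_unitary_mul hw]
  norm_num at this
  linarith

/-! ### Removing invertibility -/

theorem posSemidef_fromBlocks_smul_one {ε : ℝ} (hε : 0 ≤ ε) :
    (fromBlocks ((ε : ℂ) • (1 : Matrix (Fin n) (Fin n) ℂ))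
      ((ε : ℂ) • (1 : Matrix (Fin n) (Fin n) ℂ)) ((ε : ℂ) • (1 : Matrix (Fin n) (Fin n) ℂ))
      ((ε : ℂ) • (1 : Matrix (Fin n) (Fin n) ℂ))).PosSemidef := by
  have h := (posSemidef_self_mul_conjTranspose
    (fromRows (1 : Matrix (Fin n) (Fin n) ℂ) (1 : Matrix (Fin n) (Fin n) ℂ))).smul
    (Complex.zero_le_real.2 hε)
  rw [conjTranspose_fromRows_eq_fromCols_conjTranspose, fromRows_mul_fromCols,
    fromBlocks_smul] at h
  simpa using h

theorem Seminorm.map_add_ofReal_smul_one_le {ε : ℝ} (hε : 0 ≤ ε) (x : Matrix (Fin n) (Fin n) ℂ) :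
    N (x + (ε : ℂ) • 1) ≤ N x + ε * N 1 := by
  refine (map_add_le_add N _ _).trans ?_
  rw [map_smul_eq_mul, Complex.norm_real, Real.norm_of_nonneg hε]

theorem Seminorm.le_map_add_ofReal_smul_one {ε : ℝ} (hε : 0 ≤ ε) (x : Matrix (Fin n) (Fin n) ℂ) :
    N x ≤ N (x + (ε : ℂ) • 1) + ε * N 1 := by
  have h := map_sub_le_add N (x + (ε : ℂ) • 1) ((ε : ℂ) • 1)
  rwa [add_sub_cancel_right, map_smul_eq_mul, Complex.norm_real, Real.norm_of_nonneg hε] at h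

/-- If `x ≤ y + ε * K` for arbitrarily small `ε > 0`, then `x ≤ y`. -/
theorem le_of_forall_exists_small_mul {x y K : ℝ} (hK : 0 ≤ K)
    (h : ∀ δ > 0, ∃ ε : ℝ, 0 < ε ∧ ε < δ ∧ x ≤ y + ε * K) : x ≤ y := by
  refine le_of_forall_pos_le_add fun η hη => ?_
  obtain ⟨ε, hε, hεδ, hx⟩ := h (η / (K + 1)) (by positivity)
  rw [lt_div_iff₀ (by positivity)] at hεδ
  nlinarith

theorem IsUnitarilyInvariantNorm.map_conjTranspose_le (hN : IsUnitarilyInvariantNorm N)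
    (c : Matrix (Fin n) (Fin n) ℂ) : N cᴴ ≤ N c := by
  refine le_of_forall_exists_small_mul (K := 2 * N 1) (by positivity) fun δ hδ => ?_
  obtain ⟨ε, hε, hεδ, hu⟩ := exists_isUnit_add_smul_one c hδ
  refine ⟨ε, hε, hεδ, ?_⟩
  have h1 := hN.map_conjTranspose_of_isUnit hu
  have h2 := Seminorm.le_map_add_ofReal_smul_one (N := N) hε.le cᴴ
  have h3 := Seminorm.map_add_ofReal_smul_one_le (N := N) hε.le c
  have h4 : (c + (ε : ℂ) • (1 : Matrix (Fin n) (Fin n) ℂ))ᴴ = cᴴ + (ε : ℂ) • 1 := by simp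
  rw [h4] at h1
  linarith

theorem IsUnitarilyInvariantNorm.map_conjTranspose (hN : IsUnitarilyInvariantNorm N)
    (c : Matrix (Fin n) (Fin n) ℂ) : N cᴴ = N c :=
  le_antisymm (hN.map_conjTranspose_le c) (by simpa using hN.map_conjTranspose_le cᴴ)

theorem IsUnitarilyInvariantNorm.two_mul_map_le (hN : IsUnitarilyInvariantNorm N)
    {a b c : Matrix (Fin n) (Fin n) ℂ} (h : (fromBlocks a c cᴴ b).PosSemidef) :
    2 * N c ≤ N a + N b := by
  -- Shifting all four blocks by `ε` keeps positivity; the error is `2 * ε * N 1` from `2 * N c` and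
  -- `ε * N 1` from each of `a` and `b`.
  refine le_of_forall_exists_small_mul (K := 4 * N 1) (by positivity) fun δ hδ => ?_
  obtain ⟨ε, hε, hεδ, hu⟩ := exists_isUnit_add_smul_one c hδ
  refine ⟨ε, hε, hεδ, ?_⟩
  have h4 : (c + (ε : ℂ) • (1 : Matrix (Fin n) (Fin n) ℂ))ᴴ = cᴴ + (ε : ℂ) • 1 := by simp
  have hpos := h.add (posSemidef_fromBlocks_smul_one (n := n) hε.le)
  rw [fromBlocks_add, ← h4] at hpos
  have h1 := hN.two_mul_map_le_of_isUnit hu hpos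
  have h2 := Seminorm.le_map_add_ofReal_smul_one (N := N) hε.le c
  have h3 := Seminorm.map_add_ofReal_smul_one_le (N := N) hε.le a
  have h5 := Seminorm.map_add_ofReal_smul_one_le (N := N) hε.le b
  linarith

/-- Congruence by `diag(t, 1)` replaces `a`, `c` by `t² a`, `t c`, so a quadratic in `t` is
nonnegative and its discriminant is at most zero. -/
theorem IsUnitarilyInvariantNorm.sq_map_le_mul (hN : IsUnitarilyInvariantNorm N)
    {a b c : Matrix (Fin n) (Fin n) ℂ} (h : (fromBlocks a c cᴴ b).PosSemidef) :
    N c ^ 2 ≤ N a * N b := by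
  have hquad : ∀ t : ℝ, 0 ≤ N a * (t * t) + (-2 * N c) * t + N b := by
    intro t
    have ha := apply_nonneg N a
    have hb := apply_nonneg N b
    have hc := apply_nonneg N c
    rcases le_or_gt t 0 with ht | ht
    · have := mul_nonneg hc (neg_nonneg.2 ht)
      have := mul_nonneg ha (mul_self_nonneg t)
      linarith
    · have hB := h.conjTranspose_mul_mul_same
        (fromBlocks ((t : ℂ) • (1 : Matrix (Fin n) (Fin n) ℂ)) 0 0
          (1 : Matrix (Fin n) (Fin n) ℂ))
      rw [fromBlocks_conjTranspose, fromBlocks_multiply, fromBlocks_multiply] at hB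
      have hB' : (fromBlocks (((t * t : ℝ) : ℂ) • a) ((t : ℂ) • c) ((t : ℂ) • c)ᴴ b).PosSemidef := by
        rw [Complex.ofReal_mul]
        convert hB using 2 <;> simp [mul_smul]
      have := hN.two_mul_map_le hB'
      rw [map_smul_eq_mul, map_smul_eq_mul, Complex.norm_real, Complex.norm_real,
        Real.norm_of_nonneg ht.le, Real.norm_of_nonneg (mul_self_nonneg t)] at this
      linarith
  have := discrim_le_zero hquad
  rw [discrim] at this
  linarith

end UnitarilyInvariant

theorem posSemidef_of_sq_le_mul {p q r : ℝ} (hp : 0 ≤ p) (hr : 0 ≤ r) (h : q ^ 2 ≤ p * r) :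
    (!![(p : ℂ), (q : ℂ); (q : ℂ), (r : ℂ)] : Matrix (Fin 2) (Fin 2) ℂ).PosSemidef := by
  rcases hp.eq_or_lt with rfl | hp
  · have hq : q = 0 := by nlinarith
    subst hq
    convert PosSemidef.diagonal (n := Fin 2) (d := ![(0 : ℂ), (r : ℂ)]) ?_ using 1
    · ext i j; fin_cases i <;> fin_cases j <;> simp
    · intro i; fin_cases i <;> simp [hr]
  -- Schur complement: a rank-one positive matrix plus `diag(0, r - q²/p)`.
  · have h1 : (0 : ℝ) ≤ r - q ^ 2 / p := by
      rw [sub_nonneg, div_le_iff₀ hp]; linarith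
    have hA := (posSemidef_vecMulVec_self_star ![(p : ℂ), (q : ℂ)]).smul
      (Complex.zero_le_real.2 (inv_nonneg.2 hp.le))
    have hB := PosSemidef.diagonal (n := Fin 2) (d := ![(0 : ℂ), ((r - q ^ 2 / p : ℝ) : ℂ)]) (by
      intro i
      fin_cases i
      · simp
      · exact Complex.zero_le_real.2 h1)
    have hp' : (p : ℂ) ≠ 0 := Complex.ofReal_ne_zero.2 hp.ne'
    convert hA.add hB using 1
    ext i j
    simp only [Matrix.add_apply, Matrix.smul_apply, vecMulVec_apply]
    fin_cases i <;> fin_cases j <;> simp <;> field_simp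
    ring

theorem mainTheorem8 (n : ℕ) (N : Seminorm ℂ (Matrix (Fin n) (Fin n) ℂ))
    (hN : IsUnitarilyInvariantNorm N) :
    IsTwoPositive (fun x : Matrix (Fin n) (Fin n) ℂ => ((N x : ℝ) : ℂ)) := by
  intro a b c h
  simp only [hN.map_conjTranspose c]
  exact posSemidef_of_sq_le_mul (apply_nonneg N a) (apply_nonneg N b) (hN.sq_map_le_mul h)
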